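/- Let $n\ge 1$ and let $K\subset\mathbb R^n$ be a bounded open polytope containing the origin, $K=\bigcap_{i=1}^N\{x:\langle x,\nu_i\rangle<d_i\}$, where $d_i>0$ and $\nu_1,\dots,\nu_N$ are the distinct outer unit normals of the facets of $K$. For ${\bf a}\in\mathbb R^N$ with $\|{\bf a}\|_\infty<1$ let $$K^{\bf a}=\bigcap_{i=1}^N\{x:\langle x,\nu_i\rangle<d_i(1+a_i)\},\qquad F_i^{\bf a}=\partial K^{\bf a}\cap\{x:\langle x,\nu_i\rangle=d_i(1+a_i)\},\qquad F_i=\partial K\cap\{x:\langle x,\nu_i\rangle=d_i\}.$$ Call $K^{\bf a}$ parallel to $K$ if it has the same set of facet normals as $K$. There is a constant $C=C(n,K)>0$ such that for every crystalline surface tension $f$ (positive on the unit sphere $S^{n-1}$, with continuous, piecewise linear $1$-homogeneous extension to $\mathbb R^n$) whose Wulff shape $\{x:\langle x,\nu\rangle<f(\nu)\text{ for all }\nu\in S^{n-1}\}$ is $K$, with $M_\Phi=\sup_{\nu\in S^{n-1}}f(\nu)$, the following hold. (i) For all $K^{\bf a},K^{\bf a'}$ parallel to $K$ and every $i\in\{1,\dots,N\}$,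 with $u_i=d_i(a_i-a_i')\nu_i$, $$\mathcal H^{n-1}\bigl(F_i^{\bf a}\,\Delta\,(F_i^{\bf a'}+u_i)\bigr)\le C\,M_\Phi^{\,n-1}\,\|{\bf a}-{\bf a'}\|_\infty .$$ (ii) For every $K^{\bf a}$ parallel to $K$ and every $i$, the measures $\mathcal H^{n-1}(F_i^{\bf a})$ and $\mathcal H^{n-1}(F_i)$ are finite and $$\bigl|\mathcal H^{n-1}(F_i^{\bf a})-\mathcal H^{n-1}(F_i)\bigr|\le C\,M_\Phi^{\,n-1}\,\|{\bf a}\|_\infty .$$ -/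

import Mathlib

open MeasureTheory Set
open scoped symmDiff InnerProductSpace MeasureTheory

/-- The `1`-homogeneous extension to `ℝⁿ` of a crystalline surface tension: it is positive away from
the origin, positively `1`-homogeneous and (continuous) piecewise linear, that is, it is continuous
and at every point it agrees with one of finitely many linear functionals. -/
structure IsCrystallineSurfaceTension {n : ℕ} (f : EuclideanSpace ℝ (Fin n) → ℝ) : Prop where
  pos : ∀ x, x ≠ 0 → 0 < f x
  homogeneous : ∀ (t : ℝ) (x : EuclideanSpace ℝ (Fin n)), 0 ≤ t → f (t • x) = t * f x
  continuous : Continuous f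
  piecewise_linear : ∃ V : Finset (EuclideanSpace ℝ (Fin n)), ∀ x, ∃ v ∈ V, f x = ⟪v, x⟫_ℝ

/-- The (open) Wulff shape of a surface tension. -/
def wulffShape {n : ℕ} (f : EuclideanSpace ℝ (Fin n) → ℝ) : Set (EuclideanSpace ℝ (Fin n)) :=
  {x | ∀ u : EuclideanSpace ℝ (Fin n), ‖u‖ = 1 → ⟪x, u⟫_ℝ < f u}

/-- `M_Φ`, the supremum of the surface tension over the unit sphere. -/
noncomputable def maxTension {n : ℕ} (f : EuclideanSpace ℝ (Fin n) → ℝ) : ℝ :=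
  sSup (f '' Metric.sphere 0 1)

/-- The intersection of the open half-spaces `{x | ⟪x, ν i⟫ < b i}`. -/
def halfspaceInter {n N : ℕ} (ν : Fin N → EuclideanSpace ℝ (Fin n)) (b : Fin N → ℝ) :
    Set (EuclideanSpace ℝ (Fin n)) :=
  {x | ∀ i, ⟪x, ν i⟫_ℝ < b i}

/-- The part of the boundary of `halfspaceInter ν b` in the hyperplane `{x | ⟪x, ν i⟫ = b i}`. -/
def facet {n N : ℕ} (ν : Fin N → EuclideanSpace ℝ (Fin n)) (b : Fin N → ℝ) (i : Fin N) :
    Set (EuclideanSpace ℝ (Fin n)) :=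
  frontier (halfspaceInter ν b) ∩ {x | ⟪x, ν i⟫_ℝ = b i}

/-- The set of boundary points of `P` at which `u` is an outer normal of `P`. -/
def supportFace {n : ℕ} (P : Set (EuclideanSpace ℝ (Fin n))) (u : EuclideanSpace ℝ (Fin n)) :
    Set (EuclideanSpace ℝ (Fin n)) :=
  {x | x ∈ frontier P ∧ ∀ y ∈ P, ⟪y, u⟫_ℝ ≤ ⟪x, u⟫_ℝ}

/-- The outer unit normals of the facets (the faces of positive `(n-1)`-dimensional measure). -/
def facetNormals {n : ℕ} (P : Set (EuclideanSpace ℝ (Fin n))) : Set (EuclideanSpace ℝ (Fin n)) :=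
  {u | ‖u‖ = 1 ∧ 0 < μHE[n - 1] (supportFace P u)}

/-- `K = ⋂ i, {x | ⟪x, ν i⟫ < d i}` is a (bounded, open) polytope containing the origin, and `ν`
lists the outer unit normals of its facets, each of them once. -/
structure IsPolytope {n N : ℕ} (ν : Fin N → EuclideanSpace ℝ (Fin n)) (d : Fin N → ℝ) :
    Prop where
  injective : Function.Injective ν
  range_eq : Set.range ν = facetNormals (halfspaceInter ν d)
  pos : ∀ i, 0 < d i
  bounded : Bornology.IsBounded (halfspaceInter ν d)

/-- The distances `dᵢ (1 + aᵢ)` that define the perturbed polytope `Kᵃ`. -/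
def perturb {N : ℕ} (d a : Fin N → ℝ) : Fin N → ℝ := fun i => d i * (1 + a i)

/-- `Kᵃ` with `‖a‖_∞ < 1` is parallel to `K`: it has the same set of facet normals. -/
def IsParallel {n N : ℕ} (ν : Fin N → EuclideanSpace ℝ (Fin n)) (d a : Fin N → ℝ) : Prop :=
  ‖a‖ < 1 ∧ facetNormals (halfspaceInter ν (perturb d a)) = facetNormals (halfspaceInter ν d)

/-! Translating the facet of `Kᵃ` with normal `ν i` by `-dᵢ(1 + aᵢ)νᵢ` puts it in the fixed
hyperplane `(ν i)ᗮ`; the shift `uᵢ` is exactly what makes the two translated facets comparable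
there. Each is cut out of the hyperplane by inequalities whose right-hand sides are Lipschitz in
`a`. A point in one but not the other violates some inequality `j`, so it lies in a slab of width
`O(‖a - a'‖)` (`centeredFacet_diff_subset`, `abs_offset_sub_le`). Since `ν j` is not parallel to `ν
i`, this slab meets a ball of the hyperplane in measure `O(‖a - a'‖)`
(`exists_euclideanHausdorffMeasure_slab_le`). The factor `M_Φ ^ (n - 1)` costs nothing: `M_Φ` is
bounded below in terms of `K` (`le_maxTension`). Part (ii) is the comparison with `a' = 0`. -/

/-! ### Slabs in a hyperplane -/

/-- The part of a centred ball of `ℝᵏ` between two parallel hyperplanes has volume at most a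
constant times their distance. -/
theorem volume_ball_inter_slab_le {k : ℕ} {q : EuclideanSpace ℝ (Fin k)} (hq : ‖q‖ = 1)
    (R α β : ℝ) :
    volume {z : EuclideanSpace ℝ (Fin k) | ‖z‖ ≤ R ∧ ⟪z, q⟫_ℝ ∈ Icc α β} ≤
      ENNReal.ofReal (2 * R) ^ (k - 1) * ENNReal.ofReal (β - α) := by
  classical
  have hk : 0 < k := by
    rcases Nat.eq_zero_or_pos k with rfl | h
    · rw [Subsingleton.elim q 0, norm_zero] at hq
      exact absurd hq zero_ne_one
    · exact h
  let i₀ : Fin k := ⟨0, hk⟩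
  -- In an orthonormal basis containing `q`, the set lies in a box with one side `β - α` and all
  -- others `2 * R`.
  obtain ⟨b, hb⟩ := Orthonormal.exists_orthonormalBasis_extension_of_card_eq (𝕜 := ℝ)
    (E := EuclideanSpace ℝ (Fin k)) (ι := Fin k) (v := fun _ => q) (s := {i₀}) (by simp)
    (by
      rw [orthonormal_iff_ite]
      rintro ⟨i, rfl⟩ ⟨j, rfl⟩
      simp [Set.domRestrict, hq])
  have hb0 : b i₀ = q := hb i₀ rfl
  let l : Fin k → ℝ := fun i => if i = i₀ then α else -R
  let u : Fin k → ℝ := fun i => if i = i₀ then β else R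
  have hmp : MeasurePreserving (fun z => (b.repr z).ofLp) volume volume :=
    (PiLp.volume_preserving_ofLp (Fin k)).comp b.measurePreserving_repr
  calc volume {z : EuclideanSpace ℝ (Fin k) | ‖z‖ ≤ R ∧ ⟪z, q⟫_ℝ ∈ Icc α β}
      ≤ volume ((fun z => (b.repr z).ofLp) ⁻¹' Icc l u) := by
        apply measure_mono
        rintro z ⟨hz, hzq⟩
        have key : ∀ i, l i ≤ b.repr z i ∧ b.repr z i ≤ u i := by
          intro i
          rw [b.repr_apply_apply]
          by_cases hi : i = i₀
          · subst hi
            simpa [l, u, hb0, real_inner_comm] using hzq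
          · have h := abs_real_inner_le_norm (b i) z
            rw [b.norm_eq_one, one_mul] at h
            simpa [l, u, hi] using abs_le.1 (h.trans hz)
        exact ⟨fun i => (key i).1, fun i => (key i).2⟩
    _ = volume (Icc l u) := hmp.measure_preimage measurableSet_Icc.nullMeasurableSet
    _ = ∏ i, ENNReal.ofReal (u i - l i) := Real.volume_Icc_pi
    _ = ENNReal.ofReal (2 * R) ^ (k - 1) * ENNReal.ofReal (β - α) := by
        rw [← Finset.mul_prod_erase _ _ (Finset.mem_univ i₀), mul_comm]
        have hne : ∀ i ∈ Finset.univ.erase i₀,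
            ENNReal.ofReal (u i - l i) = ENNReal.ofReal (2 * R) := fun i hi => by
          have hi' : i ≠ i₀ := Finset.ne_of_mem_erase hi
          simp [l, u, hi', two_mul]
        rw [Finset.prod_congr rfl hne]
        simp [l, u]

/-- A linear isometric parametrization of the hyperplane orthogonal to a unit vector. -/
theorem exists_linearIsometry_range_eq_orthogonal {k : ℕ} {v : EuclideanSpace ℝ (Fin (k + 1))}
    (hv : ‖v‖ = 1) :
    ∃ g : EuclideanSpace ℝ (Fin k) →ₗᵢ[ℝ] EuclideanSpace ℝ (Fin (k + 1)),
      ∀ y, ⟪y, v⟫_ℝ = 0 ↔ ∃ z, g z = y := by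
  have hv0 : v ≠ 0 := by
    rintro rfl
    simp at hv
  have : Fact (Module.finrank ℝ (EuclideanSpace ℝ (Fin (k + 1))) = k + 1) := ⟨by simp⟩
  let e := (OrthonormalBasis.fromOrthogonalSpanSingleton (𝕜 := ℝ) k hv0).repr
  refine ⟨(Submodule.subtypeₗᵢ _).comp e.symm.toLinearIsometry, fun y => ?_⟩
  rw [real_inner_comm, ← Submodule.mem_orthogonal_singleton_iff_inner_right]
  constructor
  · intro hy
    exact ⟨e ⟨y, hy⟩, by simp⟩
  · rintro ⟨z, rfl⟩
    exact (e.symm z).2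

/-- The `k`-dimensional measure of a slab in a ball of the hyperplane `vᗮ` of `ℝᵏ⁺¹` is at most a
constant times the width of the slab. -/
theorem exists_euclideanHausdorffMeasure_slab_le {k : ℕ} {v w : EuclideanSpace ℝ (Fin (k + 1))}
    (hv : ‖v‖ = 1) (hw : ‖w‖ = 1) (h1 : w ≠ v) (h2 : w ≠ -v) {R : ℝ} (hR : 0 ≤ R) :
    ∃ C : ℝ, 0 ≤ C ∧ ∀ α β : ℝ,
      μHE[k] {y : EuclideanSpace ℝ (Fin (k + 1)) |
        ‖y‖ ≤ R ∧ ⟪y, v⟫_ℝ = 0 ∧ ⟪y, w⟫_ℝ ∈ Icc α β} ≤ ENNReal.ofReal (C * (β - α)) := by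
  obtain ⟨g, hg⟩ := exists_linearIsometry_range_eq_orthogonal hv
  have hvv : ⟪v, v⟫_ℝ = 1 := by rw [real_inner_self_eq_norm_sq, hv, one_pow]
  let c := ⟪w, v⟫_ℝ
  -- `p` represents the projection of `w` to `vᗮ`; it is nonzero because `w ≠ ±v`, and normalizing
  -- it scales the width by `‖p‖⁻¹`.
  obtain ⟨p, hp⟩ := (hg (w - c • v)).1 (by
    rw [inner_sub_left, real_inner_smul_left, hvv, mul_one, sub_self])
  have hinner : ∀ z, ⟪g z, w⟫_ℝ = ⟪z, p⟫_ℝ := by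
    intro z
    have hz : ⟪g z, v⟫_ℝ = 0 := (hg _).2 ⟨z, rfl⟩
    rw [← g.inner_map_map, hp, inner_sub_right, real_inner_smul_right, hz, mul_zero, sub_zero]
  have hp0 : p ≠ 0 := by
    rintro rfl
    rw [map_zero, eq_comm, sub_eq_zero] at hp
    have hc : |c| = 1 := by
      have := congrArg norm hp
      rwa [norm_smul, hv, hw, mul_one, Real.norm_eq_abs, eq_comm] at this
    rcases eq_or_eq_neg_of_abs_eq hc with h | h <;> rw [h] at hp
    · exact h1 (by rw [hp, one_smul])
    · exact h2 (by rw [hp, neg_one_smul])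
  have hpn : 0 < ‖p‖ := norm_pos_iff.2 hp0
  refine ⟨(2 * R) ^ (k - 1) * ‖p‖⁻¹, by positivity, fun α β => ?_⟩
  have hq : ‖‖p‖⁻¹ • p‖ = 1 := norm_smul_inv_norm hp0
  calc μHE[k] {y : EuclideanSpace ℝ (Fin (k + 1)) |
        ‖y‖ ≤ R ∧ ⟪y, v⟫_ℝ = 0 ∧ ⟪y, w⟫_ℝ ∈ Icc α β}
      ≤ μHE[k] (g '' {z | ‖z‖ ≤ R ∧ ⟪z, ‖p‖⁻¹ • p⟫_ℝ ∈ Icc (‖p‖⁻¹ * α) (‖p‖⁻¹ * β)}) := by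
        apply measure_mono
        rintro y ⟨hyR, hyv, hyw⟩
        obtain ⟨z, rfl⟩ := (hg y).1 hyv
        rw [hinner] at hyw
        rw [g.norm_map] at hyR
        refine ⟨z, ⟨hyR, ?_⟩, rfl⟩
        rw [real_inner_smul_right]
        exact ⟨by gcongr; exact hyw.1, by gcongr; exact hyw.2⟩
    _ = volume {z | ‖z‖ ≤ R ∧ ⟪z, ‖p‖⁻¹ • p⟫_ℝ ∈ Icc (‖p‖⁻¹ * α) (‖p‖⁻¹ * β)} := by
        rw [g.isometry.euclideanHausdorffMeasure_image,
          EuclideanSpace.euclideanHausdorffMeasure_eq_volume]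
    _ ≤ _ := volume_ball_inter_slab_le hq R _ _
    _ = _ := by
        rw [← ENNReal.ofReal_pow (by positivity), ← ENNReal.ofReal_mul (by positivity),
          mul_assoc, mul_sub ‖p‖⁻¹]

/-- A ball of the hyperplane `vᗮ` of `ℝᵏ⁺¹` has finite `k`-dimensional measure. -/
theorem euclideanHausdorffMeasure_hyperplane_ball_lt_top {k : ℕ}
    {v : EuclideanSpace ℝ (Fin (k + 1))} (hv : ‖v‖ = 1) (R : ℝ) :
    μHE[k] {y : EuclideanSpace ℝ (Fin (k + 1)) | ‖y‖ ≤ R ∧ ⟪y, v⟫_ℝ = 0} < ⊤ := by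
  obtain ⟨g, hg⟩ := exists_linearIsometry_range_eq_orthogonal hv
  refine lt_of_le_of_lt (b := μHE[k] (g '' Metric.closedBall 0 R)) (measure_mono ?_) ?_
  · rintro y ⟨hyR, hyv⟩
    obtain ⟨z, rfl⟩ := (hg y).1 hyv
    exact ⟨z, by simpa using hyR, rfl⟩
  · rw [g.isometry.euclideanHausdorffMeasure_image,
      EuclideanSpace.euclideanHausdorffMeasure_eq_volume]
    exact measure_closedBall_lt_top

/-! ### Facets and their translates -/

theorem isOpen_halfspaceInter {n N : ℕ} (ν : Fin N → EuclideanSpace ℝ (Fin n)) (b : Fin N → ℝ) :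
    IsOpen (halfspaceInter ν b) := by
  have : halfspaceInter ν b = ⋂ i, {x | ⟪x, ν i⟫_ℝ < b i} := by
    ext x
    simp [halfspaceInter]
  rw [this]
  exact isOpen_iInter_of_finite fun i => isOpen_lt (by fun_prop) continuous_const

/-- The facets of an intersection of half-spaces with the origin in the interior. -/
theorem facet_eq {n N : ℕ} (ν : Fin N → EuclideanSpace ℝ (Fin n)) {b : Fin N → ℝ}
    (hb : ∀ j, 0 < b j) (i : Fin N) :
    facet ν b i = {x | (∀ j, ⟪x, ν j⟫_ℝ ≤ b j) ∧ ⟪x, ν i⟫_ℝ = b i} := by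
  ext x
  simp only [facet, (isOpen_halfspaceInter ν b).frontier_eq, mem_inter_iff, mem_sdiff, mem_ofPred_eq]
  constructor
  · rintro ⟨⟨hx, -⟩, hi⟩
    refine ⟨fun j => ?_, hi⟩
    have hcl : IsClosed {x : EuclideanSpace ℝ (Fin n) | ⟪x, ν j⟫_ℝ ≤ b j} :=
      isClosed_le (by fun_prop) continuous_const
    exact closure_minimal (fun y hy => (hy j).le) hcl hx
  · rintro ⟨hx, hi⟩
    refine ⟨⟨?_, fun h => (h i).ne hi⟩, hi⟩
    -- Since every `b j` is positive, `t • x` is in the open polytope for `0 < t < 1`, so `x` is in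
    -- its closure.
    have hlim : Filter.Tendsto (fun t : ℝ => t • x) (nhdsWithin 1 (Ioo 0 1)) (nhds x) := by
      have : Filter.Tendsto (fun t : ℝ => t • x) (nhds 1) (nhds ((1 : ℝ) • x)) :=
        (continuous_id.smul continuous_const).tendsto 1
      rw [one_smul] at this
      exact this.mono_left nhdsWithin_le_nhds
    have : (nhdsWithin (1 : ℝ) (Ioo 0 1)).NeBot := right_nhdsWithin_Ioo_neBot zero_lt_one
    refine mem_closure_of_tendsto hlim ?_
    filter_upwards [self_mem_nhdsWithin] with t ht j
    rw [real_inner_smul_left]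
    nlinarith [hx j, hb j, ht.1, ht.2]

/-- The translate into the hyperplane `(ν i)ᗮ` of the facet `i` of `halfspaceInter ν b`. -/
def centeredFacet {n N : ℕ} (ν : Fin N → EuclideanSpace ℝ (Fin n)) (b : Fin N → ℝ) (i : Fin N) :
    Set (EuclideanSpace ℝ (Fin n)) :=
  {y | ⟪y, ν i⟫_ℝ = 0 ∧ ∀ j, ⟪y, ν j⟫_ℝ ≤ b j - b i * ⟪ν i, ν j⟫_ℝ}

theorem facet_eq_image_centeredFacet {n N : ℕ} {ν : Fin N → EuclideanSpace ℝ (Fin n)}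
    {b : Fin N → ℝ} (hb : ∀ j, 0 < b j) {i : Fin N} (hi : ‖ν i‖ = 1) :
    facet ν b i = (fun y => y + b i • ν i) '' centeredFacet ν b i := by
  have hii : ⟪ν i, ν i⟫_ℝ = 1 := by rw [real_inner_self_eq_norm_sq, hi, one_pow]
  rw [facet_eq ν hb]
  ext x
  constructor
  · rintro ⟨hx, hxi⟩
    refine ⟨x - b i • ν i, ⟨?_, fun j => ?_⟩, sub_add_cancel _ _⟩
    · rw [inner_sub_left, real_inner_smul_left, hii, hxi, mul_one, sub_self]
    · rw [inner_sub_left, real_inner_smul_left]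
      linarith [hx j]
  · rintro ⟨y, ⟨hyi, hy⟩, rfl⟩
    refine ⟨fun j => ?_, ?_⟩
    · rw [inner_add_left, real_inner_smul_left]
      linarith [hy j]
    · rw [inner_add_left, real_inner_smul_left, hii, hyi, mul_one, zero_add]

theorem euclideanHausdorffMeasure_image_add_right {n : ℕ} (m : ℕ) (u : EuclideanSpace ℝ (Fin n))
    (s : Set (EuclideanSpace ℝ (Fin n))) : μHE[m] ((fun y => y + u) '' s) = μHE[m] s :=
  (IsometryEquiv.addRight u).isometry.euclideanHausdorffMeasure_image s

/-- Since `b ≤ 2d`, scaling the facet down brings it into `K`. The radius depends on `K` alone,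
which makes the final constant uniform in `a`. -/
theorem norm_le_of_mem_centeredFacet {n N : ℕ} {ν : Fin N → EuclideanSpace ℝ (Fin n)}
    {b d : Fin N → ℝ} {R : ℝ} (hd : ∀ j, 0 < d j) (hb : ∀ j, 0 < b j) (hbd : ∀ j, b j ≤ 2 * d j)
    (hR : ∀ x ∈ halfspaceInter ν d, ‖x‖ ≤ R) {i : Fin N} (hi : ‖ν i‖ = 1)
    {y : EuclideanSpace ℝ (Fin n)} (hy : y ∈ centeredFacet ν b i) :
    ‖y‖ ≤ 4 * R + 2 * ∑ j, d j := by
  have hx : y + b i • ν i ∈ facet ν b i := by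
    rw [facet_eq_image_centeredFacet hb hi]
    exact ⟨y, hy, rfl⟩
  rw [facet_eq ν hb] at hx
  -- The factor `1 / 2` would only give the non-strict inequalities.
  have h4 : ((1 / 4 : ℝ) • (y + b i • ν i)) ∈ halfspaceInter ν d := by
    intro j
    rw [real_inner_smul_left]
    linarith [hx.1 j, hbd j, hd j]
  have h4R := hR _ h4
  rw [norm_smul, Real.norm_eq_abs, abs_of_pos (by norm_num)] at h4R
  have hbi : ‖b i • ν i‖ = b i := by rw [norm_smul, hi, mul_one, Real.norm_of_nonneg (hb i).le]
  have hdi : d i ≤ ∑ j, d j := Finset.single_le_sum (fun j _ => (hd j).le) (Finset.mem_univ i)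
  have htri : ‖y‖ ≤ ‖y + b i • ν i‖ + ‖b i • ν i‖ := by
    simpa using norm_sub_le (y + b i • ν i) (b i • ν i)
  linarith [hbd i]

/-- Points in one centred facet and not in the other lie in a thin slab orthogonal to a normal that
is not parallel to that of the facet. -/
theorem centeredFacet_diff_subset {n N : ℕ} {ν : Fin N → EuclideanSpace ℝ (Fin n)}
    (hν : Function.Injective ν) (hν1 : ∀ j, ‖ν j‖ = 1) {b b' : Fin N → ℝ} (hb' : ∀ j, 0 < b' j)
    {i : Fin N} {y : EuclideanSpace ℝ (Fin n)}
    (hy : y ∈ centeredFacet ν b i) (hy' : y ∉ centeredFacet ν b' i) :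
    ∃ j, ν j ≠ ν i ∧ ν j ≠ -ν i ∧ ⟪y, ν j⟫_ℝ ≤ b j - b i * ⟪ν i, ν j⟫_ℝ ∧
      b' j - b' i * ⟪ν i, ν j⟫_ℝ ≤ ⟪y, ν j⟫_ℝ := by
  have hii : ⟪ν i, ν i⟫_ℝ = 1 := by rw [real_inner_self_eq_norm_sq, hν1, one_pow]
  have hj : ∃ j, b' j - b' i * ⟪ν i, ν j⟫_ℝ < ⟪y, ν j⟫_ℝ := by
    by_contra! h
    exact hy' ⟨hy.1, h⟩
  obtain ⟨j, hj⟩ := hj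
  refine ⟨j, ?_, ?_, hy.2 j, hj.le⟩
  -- For `ν j = ν i`, injectivity gives `j = i` and the violated inequality reads `0 < 0`; for `ν j
  -- = -ν i` it reads `b' j + b' i < 0`.
  · intro h
    rw [hν h, hii, hy.1] at hj
    linarith
  · intro h
    rw [h, inner_neg_right, inner_neg_right, hii, hy.1] at hj
    linarith [hb' i, hb' j]

/-! ### Lipschitz dependence on the perturbation -/

/-- The distance from the origin to a hyperplane of the perturbed centred facet depends in a
Lipschitz way on the perturbation. -/
theorem abs_offset_sub_le {n N : ℕ} {ν : Fin N → EuclideanSpace ℝ (Fin n)}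
    (hν1 : ∀ j, ‖ν j‖ = 1) {d : Fin N → ℝ} (hd : ∀ j, 0 < d j) (a a' : Fin N → ℝ) (i j : Fin N) :
    |(perturb d a j - perturb d a i * ⟪ν i, ν j⟫_ℝ) -
      (perturb d a' j - perturb d a' i * ⟪ν i, ν j⟫_ℝ)| ≤ 2 * (∑ j, d j) * ‖a - a'‖ := by
  have hsum : ∀ l, d l ≤ ∑ j, d j := fun l =>
    Finset.single_le_sum (fun j _ => (hd j).le) (Finset.mem_univ l)
  have hl : ∀ l, |d l * (a l - a' l)| ≤ (∑ j, d j) * ‖a - a'‖ := fun l => by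
    rw [abs_mul, abs_of_pos (hd l)]
    exact mul_le_mul (hsum l) (norm_le_pi_norm (a - a') l) (abs_nonneg _)
      ((hd l).le.trans (hsum l))
  have hin : |⟪ν i, ν j⟫_ℝ| ≤ 1 := by
    simpa [hν1] using abs_real_inner_le_norm (ν i) (ν j)
  calc _ = |d j * (a j - a' j) - d i * (a i - a' i) * ⟪ν i, ν j⟫_ℝ| := by
        congr 1
        simp only [perturb]
        ring
    _ ≤ |d j * (a j - a' j)| + |d i * (a i - a' i) * ⟪ν i, ν j⟫_ℝ| := abs_sub _ _
    _ ≤ |d j * (a j - a' j)| + |d i * (a i - a' i)| := by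
        rw [abs_mul (d i * _)]
        exact add_le_add_right (mul_le_of_le_one_right (abs_nonneg _) hin) _
    _ ≤ 2 * (∑ j, d j) * ‖a - a'‖ := by linarith [hl i, hl j]

theorem perturb_pos {N : ℕ} {d a : Fin N → ℝ} (hd : ∀ j, 0 < d j) (ha : ‖a‖ < 1) (j : Fin N) :
    0 < perturb d a j := by
  have h := abs_lt.1 ((norm_le_pi_norm a j).trans_lt ha)
  exact mul_pos (hd j) (by linarith [h.1])

theorem perturb_le {N : ℕ} {d a : Fin N → ℝ} (hd : ∀ j, 0 < d j) (ha : ‖a‖ < 1) (j : Fin N) :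
    perturb d a j ≤ 2 * d j := by
  have h := abs_lt.1 ((norm_le_pi_norm a j).trans_lt ha)
  unfold perturb
  nlinarith [hd j, h.2]

theorem perturb_zero {N : ℕ} (d : Fin N → ℝ) : perturb d 0 = d := by
  funext j
  simp [perturb]

/-- The centred facets depend in a Lipschitz way on the perturbation. -/
theorem exists_centeredFacet_symmDiff_le {k N : ℕ} {ν : Fin N → EuclideanSpace ℝ (Fin (k + 1))}
    {d : Fin N → ℝ} (hν : Function.Injective ν) (hν1 : ∀ j, ‖ν j‖ = 1) (hd : ∀ j, 0 < d j)
    (hbd : Bornology.IsBounded (halfspaceInter ν d)) :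
    ∃ C : ℝ, 0 ≤ C ∧ ∀ a a' : Fin N → ℝ, ‖a‖ < 1 → ‖a'‖ < 1 → ∀ i,
      μHE[k] (centeredFacet ν (perturb d a) i ∆ centeredFacet ν (perturb d a') i) ≤
        ENNReal.ofReal (C * ‖a - a'‖) := by
  classical
  obtain ⟨R, hR0, hR⟩ := hbd.exists_pos_norm_le
  have hD : 0 ≤ ∑ j, d j := Finset.sum_nonneg fun j _ => (hd j).le
  have hslab : ∀ i j, ∃ C : ℝ, 0 ≤ C ∧ (ν j ≠ ν i → ν j ≠ -ν i → ∀ α β : ℝ,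
      μHE[k] {y : EuclideanSpace ℝ (Fin (k + 1)) | ‖y‖ ≤ 4 * R + 2 * ∑ j, d j ∧
        ⟪y, ν i⟫_ℝ = 0 ∧ ⟪y, ν j⟫_ℝ ∈ Icc α β} ≤ ENNReal.ofReal (C * (β - α))) := by
    intro i j
    by_cases h : ν j ≠ ν i ∧ ν j ≠ -ν i
    · obtain ⟨C, hC, h'⟩ := exists_euclideanHausdorffMeasure_slab_le (hν1 i) (hν1 j) h.1 h.2
        (R := 4 * R + 2 * ∑ j, d j) (by positivity)
      exact ⟨C, hC, fun _ _ => h'⟩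
    · exact ⟨0, le_rfl, fun h1 h2 => absurd ⟨h1, h2⟩ h⟩
  choose C hC0 hC using hslab
  -- Each slab has width `2δ`, that is `4 * ∑ j, d j` times `‖a - a'‖`; summing over `i` too makes
  -- the constant independent of the facet.
  refine ⟨∑ i, ∑ j, C i j * (4 * ∑ j, d j), Finset.sum_nonneg fun i _ => Finset.sum_nonneg
    fun j _ => mul_nonneg (hC0 i j) (by positivity), fun a a' ha ha' i => ?_⟩
  set δ := 2 * (∑ j, d j) * ‖a - a'‖ with hδ
  let c : Fin N → ℝ := fun j => perturb d a j - perturb d a i * ⟪ν i, ν j⟫_ℝ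
  let T : Fin N → Set (EuclideanSpace ℝ (Fin (k + 1))) := fun j =>
    {y | ‖y‖ ≤ 4 * R + 2 * ∑ j, d j ∧ ⟪y, ν i⟫_ℝ = 0 ∧ ⟪y, ν j⟫_ℝ ∈ Icc (c j - δ) (c j + δ)}
  let J : Finset (Fin N) := {j | ν j ≠ ν i ∧ ν j ≠ -ν i}
  have hδ0 : 0 ≤ δ := by positivity
  have hsub : centeredFacet ν (perturb d a) i ∆ centeredFacet ν (perturb d a') i ⊆
      ⋃ j ∈ J, T j := by
    rintro y (⟨hy, hy'⟩ | ⟨hy, hy'⟩)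
    · obtain ⟨j, h1, h2, h3, h4⟩ :=
        centeredFacet_diff_subset hν hν1 (perturb_pos hd ha') hy hy'
      have hab := abs_le.1 (abs_offset_sub_le hν1 hd a a' i j)
      refine mem_biUnion (x := j) (by simp [J, h1, h2])
        ⟨norm_le_of_mem_centeredFacet hd (perturb_pos hd ha) (perturb_le hd ha) hR (hν1 i) hy,
          hy.1, ?_, ?_⟩ <;> simp only [c] <;> linarith [hab.1, hab.2]
    · obtain ⟨j, h1, h2, h3, h4⟩ :=
        centeredFacet_diff_subset hν hν1 (perturb_pos hd ha) hy hy'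
      have hab := abs_le.1 (abs_offset_sub_le hν1 hd a a' i j)
      refine mem_biUnion (x := j) (by simp [J, h1, h2])
        ⟨norm_le_of_mem_centeredFacet hd (perturb_pos hd ha') (perturb_le hd ha') hR (hν1 i) hy,
          hy.1, ?_, ?_⟩ <;> simp only [c] <;> linarith [hab.1, hab.2]
  have hnn : ∀ j, 0 ≤ C i j * (c j + δ - (c j - δ)) := fun j =>
    mul_nonneg (hC0 i j) (by linarith)
  calc _ ≤ μHE[k] (⋃ j ∈ J, T j) := measure_mono hsub
    _ ≤ ∑ j ∈ J, μHE[k] (T j) := measure_biUnion_finset_le _ _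
    _ ≤ ∑ j ∈ J, ENNReal.ofReal (C i j * (c j + δ - (c j - δ))) := by
        refine Finset.sum_le_sum fun j hj => ?_
        have hj' := (Finset.mem_filter.1 hj).2
        exact hC i j hj'.1 hj'.2 _ _
    _ = ENNReal.ofReal (∑ j ∈ J, C i j * (c j + δ - (c j - δ))) :=
        (ENNReal.ofReal_sum_of_nonneg fun j _ => hnn j).symm
    _ ≤ _ := by
        apply ENNReal.ofReal_le_ofReal
        calc _ ≤ ∑ j, C i j * (c j + δ - (c j - δ)) :=
              Finset.sum_le_sum_of_subset_of_nonneg (Finset.subset_univ _) fun j _ _ => hnn j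
          _ = (∑ j, C i j * (4 * ∑ j, d j)) * ‖a - a'‖ := by
              rw [Finset.sum_mul]
              refine Finset.sum_congr rfl fun j _ => ?_
              rw [hδ]
              ring
          _ ≤ _ := by
              refine mul_le_mul_of_nonneg_right ?_ (norm_nonneg _)
              exact Finset.single_le_sum (f := fun i => ∑ j, C i j * (4 * ∑ j, d j))
                (fun i _ => Finset.sum_nonneg
                  fun j _ => mul_nonneg (hC0 i j) (by positivity)) (Finset.mem_univ i)

/-! ### The surface tension and the conclusion -/

/-- A surface tension with Wulff shape `K` is at least the inradius of `K` about the origin. -/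
theorem le_maxTension {n : ℕ} {f : EuclideanSpace ℝ (Fin n) → ℝ}
    (hf : IsCrystallineSurfaceTension f) {r : ℝ} (hr : 0 < r)
    (hball : Metric.ball 0 r ⊆ wulffShape f) {u : EuclideanSpace ℝ (Fin n)} (hu : ‖u‖ = 1) :
    r / 2 ≤ maxTension f := by
  have hmem : (r / 2) • u ∈ wulffShape f := hball (by
    rw [mem_ball_zero_iff, norm_smul, hu, mul_one, Real.norm_of_nonneg (by positivity)]
    linarith)
  have h := hmem u hu
  rw [real_inner_smul_left, real_inner_self_eq_norm_sq, hu, one_pow, mul_one] at h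
  exact h.le.trans (le_csSup ((isCompact_sphere 0 1).image hf.continuous).bddAbove
    ⟨u, by simpa using hu, rfl⟩)

theorem abs_toReal_measure_sub_le {α : Type*} [MeasurableSpace α] (μ : Measure α) {s t : Set α}
    (hs : μ s < ⊤) (ht : μ t < ⊤) {c : ℝ} (hc : 0 ≤ c) (h : μ (s ∆ t) ≤ ENNReal.ofReal c) :
    |(μ s).toReal - (μ t).toReal| ≤ c := by
  have key : ∀ {s t : Set α}, μ t < ⊤ → μ (s ∆ t) ≤ ENNReal.ofReal c →
      (μ s).toReal ≤ (μ t).toReal + c := by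
    intro s t ht h
    have hsub : s ⊆ t ∪ s ∆ t := fun x hx => by
      by_cases hxt : x ∈ t
      · exact Or.inl hxt
      · exact Or.inr (Or.inl ⟨hx, hxt⟩)
    have hle : μ s ≤ μ t + ENNReal.ofReal c :=
      (measure_mono hsub).trans ((measure_union_le _ _).trans (by gcongr))
    have := ENNReal.toReal_mono (ENNReal.add_lt_top.2 ⟨ht, ENNReal.ofReal_lt_top⟩).ne hle
    rwa [ENNReal.toReal_add ht.ne ENNReal.ofReal_ne_top, ENNReal.toReal_ofReal hc] at this
  have h1 := key ht h
  have h2 := key hs (symmDiff_comm s t ▸ h)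
  exact abs_le.2 ⟨by linarith, by linarith⟩

theorem mainTheorem5 {n N : ℕ} (hn : 1 ≤ n)
    (ν : Fin N → EuclideanSpace ℝ (Fin n)) (d : Fin N → ℝ) (hK : IsPolytope ν d) :
    ∃ C : ℝ, 0 < C ∧
      ∀ f : EuclideanSpace ℝ (Fin n) → ℝ, IsCrystallineSurfaceTension f →
        wulffShape f = halfspaceInter ν d →
        (∀ a a' : Fin N → ℝ, IsParallel ν d a → IsParallel ν d a' → ∀ i : Fin N,
          μHE[n - 1] (facet ν (perturb d a) i ∆
              ((fun x => x + (d i * (a i - a' i)) • ν i) '' facet ν (perturb d a') i))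
            ≤ ENNReal.ofReal (C * maxTension f ^ (n - 1) * ‖a - a'‖)) ∧
        (∀ a : Fin N → ℝ, IsParallel ν d a → ∀ i : Fin N,
          μHE[n - 1] (facet ν (perturb d a) i) < ⊤ ∧ μHE[n - 1] (facet ν d i) < ⊤ ∧
          |(μHE[n - 1] (facet ν (perturb d a) i)).toReal - (μHE[n - 1] (facet ν d i)).toReal|
            ≤ C * maxTension f ^ (n - 1) * ‖a‖) := by
  obtain ⟨k, rfl⟩ : ∃ k, n = k + 1 := ⟨n - 1, by omega⟩
  rw [Nat.add_sub_cancel]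
  have hd := hK.pos
  have hν1 : ∀ j, ‖ν j‖ = 1 := fun j => by
    have : ν j ∈ facetNormals (halfspaceInter ν d) := hK.range_eq ▸ mem_range_self j
    exact this.1
  obtain ⟨R, -, hR⟩ := hK.bounded.exists_pos_norm_le
  obtain ⟨C, hC0, hC⟩ := exists_centeredFacet_symmDiff_le hK.injective hν1 hd hK.bounded
  obtain ⟨r, hr, hball⟩ := Metric.isOpen_iff.1 (isOpen_halfspaceInter ν d) 0
    (fun j => by simpa using hd j)
  -- Chosen before `f`: `M_Φ ≥ r / 2` makes `M_Φ ^ k / (r / 2) ^ k` at least `1`, and `C + 1`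
  -- ensures positivity.
  refine ⟨(C + 1) / (r / 2) ^ k, by positivity, fun f hf hfK => ?_⟩
  -- The index supplies the unit vector `ν i` that `le_maxTension` needs.
  have hM : ∀ (_ : Fin N) {t : ℝ}, 0 ≤ t →
      C * t ≤ (C + 1) / (r / 2) ^ k * maxTension f ^ k * t := by
    intro i t ht
    have h := le_maxTension hf hr (hfK ▸ hball) (hν1 i)
    have hpow : (r / 2) ^ k ≤ maxTension f ^ k := pow_le_pow_left₀ (by positivity) h k
    gcongr
    rw [div_mul_eq_mul_div, le_div_iff₀ (by positivity)]
    exact mul_le_mul (by linarith) hpow (by positivity) (by linarith)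
  have hfin : ∀ a : Fin N → ℝ, ‖a‖ < 1 → ∀ i, μHE[k] (centeredFacet ν (perturb d a) i) < ⊤ :=
    fun a ha i => by
      refine (measure_mono fun y hy => ?_).trans_lt
        (euclideanHausdorffMeasure_hyperplane_ball_lt_top (hν1 i) (4 * R + 2 * ∑ j, d j))
      exact ⟨norm_le_of_mem_centeredFacet hd (perturb_pos hd ha) (perturb_le hd ha) hR (hν1 i) hy,
        hy.1⟩
  have hmeas : ∀ a : Fin N → ℝ, ‖a‖ < 1 → ∀ i,
      μHE[k] (facet ν (perturb d a) i) = μHE[k] (centeredFacet ν (perturb d a) i) :=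
    fun a ha i => by
      rw [facet_eq_image_centeredFacet (perturb_pos hd ha) (hν1 i),
        euclideanHausdorffMeasure_image_add_right]
  refine ⟨fun a a' ha ha' i => ?_, fun a ha i => ?_⟩
  -- The shifts add up: `dᵢ(1 + a'ᵢ) + dᵢ(aᵢ - a'ᵢ) = dᵢ(1 + aᵢ)`, so both facets are images under
  -- one translation.
  · have himage : (fun x => x + (d i * (a i - a' i)) • ν i) '' facet ν (perturb d a') i =
        (fun y => y + perturb d a i • ν i) '' centeredFacet ν (perturb d a') i := by
      rw [facet_eq_image_centeredFacet (perturb_pos hd ha'.1) (hν1 i), image_image]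
      refine image_congr fun y _ => ?_
      rw [add_assoc, ← add_smul]
      congr 2
      simp only [perturb]
      ring
    rw [himage, facet_eq_image_centeredFacet (perturb_pos hd ha.1) (hν1 i),
      ← image_symmDiff (add_left_injective _), euclideanHausdorffMeasure_image_add_right]
    exact (hC a a' ha.1 ha'.1 i).trans (ENNReal.ofReal_le_ofReal (hM i (norm_nonneg _)))
  · have h0 : ‖(0 : Fin N → ℝ)‖ < 1 := by simp
    have hm0 := hmeas 0 h0 i
    have hf0 := hfin 0 h0 i
    have hC' := hC a 0 ha.1 h0 i
    rw [perturb_zero] at hm0 hf0 hC'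
    rw [sub_zero] at hC'
    rw [hmeas a ha.1 i, hm0]
    exact ⟨hfin a ha.1 i, hf0, (abs_toReal_measure_sub_le _ (hfin a ha.1 i) hf0
      (by positivity) hC').trans (hM i (norm_nonneg _))⟩
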